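/- Let $\nu$ be a nonatomic, $\sigma$-finite measure on $[0,1]$ with $\nu([0,1])=\infty$ and $\int_0^1 w\,\nu(dw)<\infty$. Let $(w_i)_{i\in\mathbb N}$ be a random sequence in $[0,1]$ distributed as a Poisson point process with rate measure $\nu$, that is, $\#\{i: w_i\in A\}\sim\mathrm{Poisson}(\nu(A))$ for every measurable $A\subseteq[0,1]$ with $\nu(A)<\infty$, and the counts $\#\{i:w_i\in A_j\}$ are independent for every finite collection of disjoint measurable sets $A_j$. Put $w_{\{i,j\}}=w_iw_j$ if $i\ne j$ and $w_{\{i,i\}}=0$. Let $n\ge 0$ be an integer and suppose that, conditionally on $(w_i)_i$, the edge multiplicities $M_{\{i,j\}}$ are independent with $M_{\{i,j\}}\sim\mathrm{Binom}(n,w_{\{i,j\}})$. Let $E_n$ be the multiset that contains each edge $\{i,j\}$ with multiplicity $M_{\{i,j\}}$, let $V_n=\{i:\sum_j M_{\{i,j\}}>0\}$ be the set of active vertices, let $\bar E_n$ be the set of edges of multiplicity at least $1$ in $E_n$, and let $\bar V_n=V_n$ be the set of active vertices of the resulting binary graph. Then the following expectations are finite and \[ \mathbb E|\bar V_n|=\mathbb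 E|V_n|=\int\Bigl[1-\exp\Bigl(-\int\bigl(1-(1-wv)^n\bigr)\,\nu(dv)\Bigr)\Bigr]\nu(dw), \] \[ \mathbb E|E_n|=\frac n2\iint wv\,\nu(dw)\,\nu(dv),\qquad \mathbb E|\bar E_n|=\frac12\iint\bigl(1-(1-wv)^n\bigr)\,\nu(dw)\,\nu(dv), \] where all the integrals on the right-hand sides converge. -/

import Mathlib

open MeasureTheory ProbabilityTheory
open scoped ENNReal unitInterval

noncomputable section

/-- The number `#{i : wᵢ ∈ A}` of points of the sequence `w` in the set `A`. -/
def pointCount {Ω : Type*} (w : ℕ → Ω → I) (A : Set I) (ω : Ω) : ℕ∞ :=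
  {i : ℕ | w i ω ∈ A}.encard

/-- `(wᵢ) ∼ PPP(ν)` on `[0,1]`: counts in sets of finite `ν`-measure are Poisson, and counts in
finitely many disjoint sets are independent. -/
structure IsPoissonPointProcess {Ω : Type*} [MeasurableSpace Ω] (P : Measure Ω)
    (w : ℕ → Ω → I) (ν : Measure I) : Prop where
  measurable : ∀ i, Measurable (w i)
  poisson : ∀ A : Set I, MeasurableSet A → ν A ≠ ∞ →
    HasLaw (pointCount w A) ((poissonMeasure (ν A).toNNReal).map (fun k : ℕ => (k : ℕ∞))) P
  indep : ∀ (J : ℕ) (A : Fin J → Set I), (∀ j, MeasurableSet (A j)) →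
    Pairwise (fun j k => Disjoint (A j) (A k)) →
    iIndepFun (fun j => pointCount w (A j)) P

/-- The edge rates: `w_{i,j} = wᵢ wⱼ` if `i ≠ j`, and `w_{i,i} = 0`. -/
def edgeRate (w : ℕ → I) : Sym2 ℕ → I :=
  Sym2.lift ⟨fun i j => if i = j then 0 else w i * w j, fun i j => by
    simp only [eq_comm (a := i) (b := j), mul_comm (w i) (w j)]⟩

/-- Conditionally on the weights `w`, the multiplicities `M e` are independent, and `M e` is
binomial with parameters `n` and the rate of `e`: every finite family of them has the
corresponding conditional joint probability mass function given `σ(w₀, w₁, …)`. -/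
structure IsEdgeMultiplicity {Ω : Type*} [MeasurableSpace Ω] (P : Measure Ω)
    (w : ℕ → Ω → I) (n : ℕ) (M : Sym2 ℕ → Ω → ℕ) : Prop where
  measurable : ∀ e, Measurable (M e)
  condLaw : ∀ (S : Finset (Sym2 ℕ)) (k : Sym2 ℕ → ℕ),
    P⟦{ω | ∀ e ∈ S, M e ω = k e} |
        MeasurableSpace.comap (fun ω (i : ℕ) => w i ω) MeasurableSpace.pi⟧
      =ᵐ[P] fun ω => ∏ e ∈ S, (binomial n (edgeRate (fun i => w i ω) e)).real {k e}

/-- The active vertices of a multigraph given by its edge multiplicities. -/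
def activeVertices (G : Sym2 ℕ → ℕ) : Set ℕ := {i | ∃ j, 0 < G s(i, j)}

/-- The number of active vertices, possibly `∞`. -/
def vertexCount (G : Sym2 ℕ → ℕ) : ℝ≥0∞ := ((activeVertices G).encard : ℝ≥0∞)

/-- The number of edges counted with multiplicity, possibly `∞`. -/
def edgeCount (G : Sym2 ℕ → ℕ) : ℝ≥0∞ := ∑' e, (G e : ℝ≥0∞)

/-- The binary graph of a multigraph: the same edges, each with multiplicity one. -/
def binaryGraph (G : Sym2 ℕ → ℕ) : Sym2 ℕ → ℕ := fun e => if 0 < G e then 1 else 0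

/-- The `[0,∞]`-valued random variable `X` is measurable with finite expectation `a`. -/
def HasExpectation {Ω : Type*} [MeasurableSpace Ω] (P : Measure Ω)
    (X : Ω → ℝ≥0∞) (a : ℝ) : Prop :=
  AEMeasurable X P ∧ 0 ≤ a ∧ ∫⁻ ω, X ω ∂P = ENNReal.ofReal a

end

/-! Each expectation reduces to a sum over points, which the Mecke formula evaluates: summing over
the points a functional of a point and of the remaining points gives, in expectation, an integral
over `ν` of the functional of an added point and an independent copy of the process.

Given the weights, vertex `i` is inactive with probability `∏_{j ≠ i} (1 - wᵢ wⱼ)ⁿ`. The Mecke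
formula followed by the Poisson generating function turns the expected sum of the complementary
probabilities into the integral of `1 - exp(-∫ (1 - (1 - wv)ⁿ) ν(dv))`. For edges, the conditional
means are `φ (wᵢ wⱼ)` with `φ x = n x` or `φ x = 1 - (1 - x)ⁿ`; the second factorial moment measure
of the process is `ν ⊗ ν`, and the factor `1/2` passes from ordered to unordered pairs.

Both instances of the Mecke formula are proved by rounding weights down to a dyadic grid. The
functionals ignore weight `0`, and integrability of `w` makes every other grid cell of finite
measure. So only finitely many independent Poisson counts matter, and the formula becomes the
Stein–Chen identity `lintegral_pi_poissonMeasure_mul_sub_single`. Refining the grid increases the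
rounded weights to the true ones, and monotone and dominated convergence give
`IsPoissonPointProcess.tsum_tsum_lintegral_eq` and `IsPoissonPointProcess.tsum_lintegral_iSup_eq`.
-/

/-! ### Vectors of independent Poisson variables -/

/-- The Stein–Chen identity for a vector of independent Poisson variables. -/
theorem lintegral_pi_poissonMeasure_mul_sub_single {J : ℕ} (r : Fin J → NNReal)
    (F : (Fin J → ℕ) → ℝ≥0∞) (l : Fin J) :
    ∫⁻ k, (k l : ℝ≥0∞) * F (k - Pi.single l 1) ∂(Measure.pi fun m => poissonMeasure (r m)) =
      r l * ∫⁻ k, F k ∂(Measure.pi fun m => poissonMeasure (r m)) := by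
  have hone (s : NNReal) (j : ℕ) :
      ((j + 1 : ℕ) : ℝ≥0∞) * poissonMeasure s {j + 1} = s * poissonMeasure s {j} := by
    rw [poissonMeasure_singleton, poissonMeasure_singleton, ← ENNReal.ofReal_natCast,
      ← ENNReal.ofReal_coe_nnreal, ← ENNReal.ofReal_mul (by positivity),
      ← ENNReal.ofReal_mul (by positivity)]
    congr 1
    rw [Nat.factorial_succ]
    push_cast
    field_simp
    ring
  rw [lintegral_countable', lintegral_countable', ← ENNReal.tsum_mul_left]
  have hinj : Function.Injective fun k : Fin J → ℕ => k + Pi.single l 1 := add_left_injective _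
  -- Reindex by the shift `k ↦ k + e_l`. The vectors missed by the shift have `k l = 0`, so the
  -- factor `k l` kills their terms.
  rw [← hinj.tsum_eq]
  · refine tsum_congr fun k => ?_
    simp only [Measure.pi_singleton, add_tsub_cancel_right, Pi.add_apply, Pi.single_eq_same]
    rw [← Finset.mul_prod_erase _ _ (Finset.mem_univ l),
      ← Finset.mul_prod_erase _ (fun m => poissonMeasure (r m) {k m}) (Finset.mem_univ l)]
    have hrest : ∏ m ∈ Finset.univ.erase l,
        poissonMeasure (r m) {k m + (Pi.single l 1 : Fin J → ℕ) m} =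
        ∏ m ∈ Finset.univ.erase l, poissonMeasure (r m) {k m} := by
      refine Finset.prod_congr rfl fun m hm => ?_
      rw [Pi.single_eq_of_ne (Finset.ne_of_mem_erase hm), add_zero]
    rw [hrest, Pi.single_eq_same]
    have := hone (r l) (k l)
    calc _ = (((k l + 1 : ℕ) : ℝ≥0∞) * poissonMeasure (r l) {k l + 1}) * F k *
          ∏ m ∈ Finset.univ.erase l, poissonMeasure (r m) {k m} := by ring
      _ = _ := by rw [this]; ring
  · intro k hk
    have hkl : k l ≠ 0 := by
      rintro h
      simp [h] at hk
    refine ⟨k - Pi.single l 1, ?_⟩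
    ext m
    rcases eq_or_ne m l with rfl | hm
    · simp only [Pi.add_apply, Pi.sub_apply, Pi.single_eq_same]
      omega
    · simp [hm]

theorem lintegral_natCast_poissonMeasure (r : NNReal) :
    ∫⁻ k : ℕ, (k : ℝ≥0∞) ∂(poissonMeasure r) = r := by
  have h := lintegral_pi_poissonMeasure_mul_sub_single (J := 1) (fun _ => r) (fun _ => 1) 0
  have hev := (measurePreserving_eval (fun _ : Fin 1 => poissonMeasure r) 0).lintegral_comp
    (f := fun k : ℕ => (k : ℝ≥0∞)) .of_discrete
  simp only [Function.eval] at hev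
  simpa [hev] using h

theorem integral_pow_poissonMeasure (r : NNReal) (q : ℝ) :
    ∫ k : ℕ, q ^ k ∂(poissonMeasure r) = Real.exp (-(r * (1 - q))) := by
  rw [integral_poissonMeasure]
  have h : ∀ k : ℕ, (Real.exp (-r) * (r : ℝ) ^ k / k.factorial) • q ^ k =
      Real.exp (-r) * ((r * q) ^ k / k.factorial) := fun k => by
    rw [smul_eq_mul, mul_pow]; ring
  simp_rw [h]
  rw [tsum_mul_left, (NormedSpace.expSeries_div_hasSum_exp ((r : ℝ) * q)).tsum_eq,
    ← Real.exp_eq_exp_ℝ, ← Real.exp_add]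
  ring_nf

theorem lintegral_one_sub_prod_pow_pi_poissonMeasure {J : ℕ} (r : Fin J → NNReal)
    (q : Fin J → ℝ) (hq0 : ∀ m, 0 ≤ q m) (hq1 : ∀ m, q m ≤ 1) :
    ∫⁻ k, ENNReal.ofReal (1 - ∏ m, q m ^ k m) ∂(Measure.pi fun m => poissonMeasure (r m)) =
      ENNReal.ofReal (1 - Real.exp (-∑ m, r m * (1 - q m))) := by
  have hle (k : Fin J → ℕ) : ∏ m, q m ^ k m ≤ 1 :=
    Finset.prod_le_one (fun m _ => pow_nonneg (hq0 m) _) fun m _ => pow_le_one₀ (hq0 m) (hq1 m)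
  have hnn (k : Fin J → ℕ) : 0 ≤ ∏ m, q m ^ k m :=
    Finset.prod_nonneg fun m _ => pow_nonneg (hq0 m) _
  have hint : Integrable (fun k : Fin J → ℕ => ∏ m, q m ^ k m)
      (Measure.pi fun m => poissonMeasure (r m)) :=
    .of_bound (Measurable.of_discrete.aestronglyMeasurable) 1 <| .of_forall fun k => by
      rw [Real.norm_of_nonneg (hnn k)]; exact hle k
  have hint' : Integrable (fun k : Fin J → ℕ => 1 - ∏ m, q m ^ k m)
      (Measure.pi fun m => poissonMeasure (r m)) := (integrable_const 1).sub hint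
  rw [← ofReal_integral_eq_lintegral_ofReal hint'
    (.of_forall fun k => by simpa using hle k), integral_sub (integrable_const 1) hint,
    integral_fintype_prod_eq_prod (fun m (j : ℕ) => q m ^ j)]
  simp_rw [integral_pow_poissonMeasure, ← Real.exp_sum, Finset.sum_neg_distrib]
  simp

theorem lintegral_sum_mul_pi_poissonMeasure {J : ℕ} (r : Fin J → NNReal) (h : Fin J → ℝ≥0∞) :
    ∫⁻ k, ∑ m, h m * (k m : ℝ≥0∞) ∂(Measure.pi fun m => poissonMeasure (r m)) =
      ∑ m, h m * r m := by
  rw [lintegral_finsetSum _ fun _ _ => .of_discrete]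
  refine Finset.sum_congr rfl fun m _ => ?_
  rw [lintegral_const_mul _ .of_discrete]
  have hev := (measurePreserving_eval (fun m => poissonMeasure (r m)) m).lintegral_comp
    (f := fun k : ℕ => (k : ℝ≥0∞)) .of_discrete
  simp only [Function.eval] at hev
  rw [hev, lintegral_natCast_poissonMeasure]

/-! ### Sums over a sequence of points with finitely many levels -/

/-- Summing a function of the level of a point, level by level; points of level `0` do not
contribute. -/
theorem tsum_ite_comp_eq_sum_encard {J : ℕ} (x : ℕ → Fin (J + 1)) (s : Set ℕ)
    [DecidablePred (· ∈ s)] (F : Fin (J + 1) → ℝ≥0∞) (hF : F 0 = 0) :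
    ∑' i, (if i ∈ s then F (x i) else 0) =
      ∑ l : Fin J, ({i | i ∈ s ∧ x i = l.succ}.encard : ℝ≥0∞) * F l.succ := by
  classical
  have h (i : ℕ) : (if i ∈ s then F (x i) else 0) =
      ∑ l : Fin J, {i | i ∈ s ∧ x i = l.succ}.indicator (fun _ => F l.succ) i := by
    by_cases hi : i ∈ s
    · simp only [hi, if_true, Set.indicator_apply, Set.mem_ofPred_eq, true_and]
      rcases Fin.eq_zero_or_eq_succ (x i) with h0 | ⟨l, hl⟩
      · simp [h0, hF, (Fin.succ_ne_zero _).symm]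
      · simp [hl, Fin.succ_inj]
    · simp [hi]
  simp_rw [h]
  rw [Summable.tsum_finsetSum fun _ _ => ENNReal.summable]
  refine Finset.sum_congr rfl fun l _ => ?_
  rw [← tsum_subtype, ENNReal.tsum_set_const]

/-- Excluding the point `i` lowers the count at its own level by one and changes no other. This is
the source of the shift `k - Pi.single l 1` to which Stein–Chen applies. -/
theorem encard_ne_and_eq_succ {J : ℕ} (x : ℕ → Fin (J + 1)) (k : Fin J → ℕ)
    (hk : ∀ l, {i | x i = l.succ}.encard = k l) {i : ℕ} {l : Fin J} (hi : x i = l.succ)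
    (m : Fin J) : {j | i ≠ j ∧ x j = m.succ}.encard = ((k - Pi.single l 1 : Fin J → ℕ) m : ℕ) := by
  rcases eq_or_ne m l with rfl | hm
  · have h : {j | i ≠ j ∧ x j = m.succ} = {j | x j = m.succ} \ {i} := by
      ext j; simp [eq_comm, and_comm]
    rw [h, Set.encard_sdiff_singleton_of_mem (by exact hi), hk]
    simp
  · have h : {j | i ≠ j ∧ x j = m.succ} = {j | x j = m.succ} := by
      ext j
      simp only [Set.mem_ofPred_eq, and_iff_right_iff_imp]
      rintro hj rfl
      exact hm (Fin.succ_injective _ (hj.symm.trans hi))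
    rw [h, hk]
    simp [hm]

theorem tsum_tsum_ne_eq_sum {J : ℕ} (x : ℕ → Fin (J + 1)) (k : Fin J → ℕ)
    (hk : ∀ l, {i | x i = l.succ}.encard = k l) (h : Fin (J + 1) → Fin (J + 1) → ℝ≥0∞)
    (h0l : ∀ l, h 0 l = 0) (hl0 : ∀ l, h l 0 = 0) :
    ∑' i, ∑' j, (if i ≠ j then h (x i) (x j) else 0) =
      ∑ l : Fin J, (k l : ℝ≥0∞) *
        ∑ m : Fin J, h l.succ m.succ * (((k - Pi.single l 1 : Fin J → ℕ) m : ℕ) : ℝ≥0∞) := by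
  let F : Fin (J + 1) → ℝ≥0∞ := Fin.cons 0 fun l => ∑ m : Fin J, h l.succ m.succ *
    (((k - Pi.single l 1 : Fin J → ℕ) m : ℕ) : ℝ≥0∞)
  have hF (i : ℕ) : ∑' j, (if i ≠ j then h (x i) (x j) else 0) = F (x i) := by
    rcases Fin.eq_zero_or_eq_succ (x i) with hi | ⟨l, hi⟩
    · simp [hi, h0l, F]
    · have := tsum_ite_comp_eq_sum_encard x {j | i ≠ j} (h (x i)) (hl0 _)
      simp only [Set.mem_ofPred_eq] at this
      rw [this, hi]
      simp only [F, Fin.cons_succ]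
      refine Finset.sum_congr rfl fun m _ => ?_
      rw [encard_ne_and_eq_succ x k hk hi, mul_comm]
      simp
  simp_rw [hF]
  have := tsum_ite_comp_eq_sum_encard x Set.univ F rfl
  simp only [Set.mem_univ, if_true, true_and, hk] at this
  rw [this]
  simp [F]

/-- Only finitely many points have nonzero level and all others contribute the factor `1`, so the
partial products are eventually constant and the increasing supremum is attained. The supremum is
the form in which the probability of being active arises. -/
theorem tsum_iSup_one_sub_prod_eq_sum {J : ℕ} (x : ℕ → Fin (J + 1)) (k : Fin J → ℕ)
    (hk : ∀ l, {i | x i = l.succ}.encard = k l) (g : Fin (J + 1) → Fin (J + 1) → ℝ)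
    (hg_nonneg : ∀ l m, 0 ≤ g l m) (hg_le : ∀ l m, g l m ≤ 1)
    (h0l : ∀ l, g 0 l = 1) (hl0 : ∀ l, g l 0 = 1) :
    ∑' i, ⨆ N : ℕ, ENNReal.ofReal
        (1 - ∏ j ∈ Finset.range N, (if i ≠ j then g (x i) (x j) else 1)) =
      ∑ l : Fin J, (k l : ℝ≥0∞) *
        ENNReal.ofReal (1 - ∏ m : Fin J, g l.succ m.succ ^ (k - Pi.single l 1 : Fin J → ℕ) m) := by
  classical
  let F : Fin (J + 1) → ℝ≥0∞ := Fin.cons 0 fun l =>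
    ENNReal.ofReal (1 - ∏ m : Fin J, g l.succ m.succ ^ (k - Pi.single l 1 : Fin J → ℕ) m)
  have hfin : {j | x j ≠ 0}.Finite := by
    have : {j | x j ≠ 0} = ⋃ l : Fin J, {j | x j = l.succ} := by
      ext j
      simp only [Set.mem_ofPred_eq, Set.mem_iUnion]
      exact ⟨fun h => (Fin.eq_zero_or_eq_succ (x j)).resolve_left h, fun ⟨l, hl⟩ => by simp [hl]⟩
    rw [this]
    exact Set.finite_iUnion fun l => Set.finite_of_encard_eq_coe (hk l)
  have hF (i : ℕ) : ⨆ N : ℕ, ENNReal.ofReal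
      (1 - ∏ j ∈ Finset.range N, (if i ≠ j then g (x i) (x j) else 1)) = F (x i) := by
    rcases Fin.eq_zero_or_eq_succ (x i) with hi | ⟨l, hi⟩
    · simp [hi, h0l, F]
    obtain ⟨N₀, hN₀⟩ := hfin.bddAbove
    have hprod (N : ℕ) (hN : N₀ < N) :
        ∏ j ∈ Finset.range N, (if i ≠ j then g (x i) (x j) else 1) =
          ∏ m : Fin J, g l.succ m.succ ^ (k - Pi.single l 1 : Fin J → ℕ) m := by
      -- Group the factors by level; level `0` gives `1`, and level `m.succ` gives a power whose
      -- exponent is its count without `i`.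
      rw [← Finset.prod_filter, ← Finset.prod_fiberwise _ x, Fin.prod_univ_succ,
        Finset.prod_eq_one, one_mul]
      · refine Finset.prod_congr rfl fun m _ => ?_
        rw [Finset.prod_congr rfl (g := fun _ => g l.succ m.succ), Finset.prod_const]
        · congr 1
          have hset := encard_ne_and_eq_succ x k hk hi m
          have hco : {j | i ≠ j ∧ x j = m.succ} =
              (↑(((Finset.range N).filter (i ≠ ·)).filter (x · = m.succ)) : Set ℕ) := by
            ext j
            simp only [Set.mem_ofPred_eq, Finset.coe_filter, Finset.mem_filter, Finset.mem_range]
            refine ⟨fun ⟨h1, h2⟩ => ⟨⟨?_, h1⟩, h2⟩, fun ⟨⟨_, h1⟩, h2⟩ => ⟨h1, h2⟩⟩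
            exact (hN₀ (by simp [h2] : j ∈ {j | x j ≠ 0})).trans_lt hN
          rw [hco, Set.encard_coe_eq_coe_finsetCard] at hset
          exact_mod_cast hset
        · intro j hj
          rw [(Finset.mem_filter.1 hj).2, hi]
      · intro j hj
        rw [(Finset.mem_filter.1 hj).2, hl0]
    have hmono : Monotone fun N : ℕ => ENNReal.ofReal
        (1 - ∏ j ∈ Finset.range N, (if i ≠ j then g (x i) (x j) else 1)) := by
      refine monotone_nat_of_le_succ fun N => ENNReal.ofReal_le_ofReal ?_
      rw [Finset.prod_range_succ]
      refine sub_le_sub_left (mul_le_of_le_one_right (Finset.prod_nonneg fun j _ => ?_) ?_) _ <;>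
        split_ifs <;> simp [hg_nonneg, hg_le]
    refine iSup_eq_of_tendsto hmono (tendsto_const_nhds.congr' ?_)
    filter_upwards [Filter.eventually_gt_atTop N₀] with N hN
    rw [hprod N hN, hi]
    simp [F]
  simp_rw [hF]
  have := tsum_ite_comp_eq_sum_encard x Set.univ F rfl
  simp only [Set.mem_univ, if_true, true_and, hk] at this
  rw [this]
  simp [F]

/-! ### The Mecke formula for functionals of finitely many levels -/

theorem measurable_pointCount {Ω : Type*} [MeasurableSpace Ω] {w : ℕ → Ω → I}
    (hw : ∀ i, Measurable (w i)) {A : Set I} (hA : MeasurableSet A) :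
    Measurable (pointCount w A) := by
  refine measurable_encard.comp (measurable_set_iff.2 fun i => ?_)
  exact measurable_mem.2 (hw i hA)

theorem lintegral_comp_level {J : ℕ} {ν : Measure I} {a : I → Fin (J + 1)} (ha : Measurable a)
    (F : Fin (J + 1) → ℝ≥0∞) (hF : F 0 = 0) :
    ∫⁻ x, F (a x) ∂ν = ∑ l : Fin J, F l.succ * ν (a ⁻¹' {l.succ}) := by
  rw [← lintegral_map (f := F) .of_discrete ha, lintegral_fintype, Fin.sum_univ_succ, hF, zero_mul,
    zero_add]
  simp_rw [Measure.map_apply ha (measurableSet_singleton _)]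

theorem integral_comp_level {J : ℕ} {ν : Measure I} {a : I → Fin (J + 1)} (ha : Measurable a)
    (hfin : ∀ l : Fin J, ν (a ⁻¹' {l.succ}) ≠ ∞) (F : Fin (J + 1) → ℝ) (hF : F 0 = 0)
    (hF_nonneg : ∀ l, 0 ≤ F l) :
    ∫ x, F (a x) ∂ν = ∑ l : Fin J, ((ν (a ⁻¹' {l.succ})).toNNReal : ℝ) * F l.succ := by
  rw [integral_eq_lintegral_of_nonneg_ae (.of_forall fun x => hF_nonneg _)
    ((Measurable.of_discrete.comp ha).aestronglyMeasurable),
    lintegral_comp_level ha (fun l => ENNReal.ofReal (F l)) (by simp [hF]),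
    ENNReal.toReal_sum fun l _ => ENNReal.mul_ne_top ENNReal.ofReal_ne_top (hfin l)]
  refine Finset.sum_congr rfl fun l _ => ?_
  rw [ENNReal.toReal_mul, ENNReal.toReal_ofReal (hF_nonneg _), mul_comm]
  rfl

section Level

variable {Ω : Type*} [MeasurableSpace Ω] {P : Measure Ω}
  {ν : Measure I} {w : ℕ → Ω → I} {J : ℕ} {a : I → Fin (J + 1)}

/-- The numbers of points at the levels `1, …, J`. -/
noncomputable def levelCount (w : ℕ → Ω → I) (a : I → Fin (J + 1)) (ω : Ω) (l : Fin J) : ℕ :=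
  (pointCount w (a ⁻¹' {l.succ}) ω).toNat

theorem IsPoissonPointProcess.hasLaw_levelCount [IsProbabilityMeasure P]
    (hw : IsPoissonPointProcess P w ν)
    (ha : Measurable a) (hfin : ∀ l : Fin J, ν (a ⁻¹' {l.succ}) ≠ ∞) :
    HasLaw (levelCount w a)
      (Measure.pi fun l : Fin J => poissonMeasure (ν (a ⁻¹' {l.succ})).toNNReal) P := by
  have hB (l : Fin J) : MeasurableSet (a ⁻¹' {l.succ}) := ha (measurableSet_singleton _)
  have hm (l : Fin J) : Measurable (pointCount w (a ⁻¹' {l.succ})) :=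
    measurable_pointCount hw.measurable (hB l)
  have htoNat : Measurable ENat.toNat := .of_discrete
  have hind := (hw.indep J (fun l => a ⁻¹' {l.succ}) hB fun l m hlm =>
    Disjoint.preimage a (by simpa using hlm)).comp (fun _ => ENat.toNat) fun _ => htoNat
  have hK (l : Fin J) : Measurable fun ω => levelCount w a ω l := htoNat.comp (hm l)
  refine ⟨(measurable_pi_lambda _ hK).aemeasurable, ?_⟩
  have := (iIndepFun_iff_map_fun_eq_pi_map fun l => (hK l).aemeasurable).1 hind
  refine this.trans ?_
  congr 1
  ext1 l
  have hlaw := (hw.poisson _ (hB l) (hfin l)).map_eq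
  change P.map (ENat.toNat ∘ pointCount w (a ⁻¹' {l.succ})) = _
  rw [← Measure.map_map htoNat (hm l), hlaw, Measure.map_map htoNat .of_discrete]
  -- `ENat.toNat` undoes the cast `ℕ → ℕ∞`, so their composition is the identity.
  exact Measure.map_id

theorem IsPoissonPointProcess.ae_encard_eq_levelCount (hw : IsPoissonPointProcess P w ν)
    (ha : Measurable a) (hfin : ∀ l : Fin J, ν (a ⁻¹' {l.succ}) ≠ ∞) :
    ∀ᵐ ω ∂P, ∀ l : Fin J, {i | a (w i ω) = l.succ}.encard = levelCount w a ω l := by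
  refine ae_all_iff.2 fun l => ?_
  have h : ∀ᵐ ω ∂P, pointCount w (a ⁻¹' {l.succ}) ω ≠ ⊤ := by
    have hlaw := hw.poisson _ (ha (measurableSet_singleton l.succ)) (hfin l)
    rw [hlaw.ae_iff (p := (· ≠ ⊤)) .of_discrete, ae_map_iff Measurable.of_discrete.aemeasurable
      .of_discrete]
    exact .of_forall fun k => ENat.natCast_ne_top k
  filter_upwards [h] with ω hω
  exact (ENat.natCast_toNat hω).symm

/-- The Mecke formula in finite form: Stein–Chen for each level, with the measure of the level as
its Poisson rate. -/
theorem IsPoissonPointProcess.lintegral_sum_levelCount_mul [IsProbabilityMeasure P]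
    (hw : IsPoissonPointProcess P w ν)
    (ha : Measurable a) (hfin : ∀ l : Fin J, ν (a ⁻¹' {l.succ}) ≠ ∞)
    (F : Fin J → (Fin J → ℕ) → ℝ≥0∞) :
    ∫⁻ ω, ∑ l, (levelCount w a ω l : ℝ≥0∞) * F l (levelCount w a ω - Pi.single l 1) ∂P =
      ∑ l : Fin J, (∫⁻ k, F l k ∂(Measure.pi fun l : Fin J =>
        poissonMeasure (ν (a ⁻¹' {l.succ})).toNNReal)) * ν (a ⁻¹' {l.succ}) := by
  refine ((hw.hasLaw_levelCount ha hfin).lintegral_comp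
    (f := fun k : Fin J → ℕ => ∑ l, (k l : ℝ≥0∞) * F l (k - Pi.single l 1))
    Measurable.of_discrete.aemeasurable).trans ?_
  rw [lintegral_finsetSum _ fun _ _ => .of_discrete]
  refine Finset.sum_congr rfl fun l _ => ?_
  rw [lintegral_pi_poissonMeasure_mul_sub_single, ENNReal.coe_toNNReal (hfin l), mul_comm]

theorem IsPoissonPointProcess.lintegral_tsum_tsum_level [IsProbabilityMeasure P]
    (hw : IsPoissonPointProcess P w ν)
    (ha : Measurable a) (hfin : ∀ l : Fin J, ν (a ⁻¹' {l.succ}) ≠ ∞)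
    (h : Fin (J + 1) → Fin (J + 1) → ℝ≥0∞) (h0l : ∀ l, h 0 l = 0) (hl0 : ∀ l, h l 0 = 0) :
    ∫⁻ ω, ∑' i, ∑' j, (if i ≠ j then h (a (w i ω)) (a (w j ω)) else 0) ∂P =
      ∫⁻ x, ∫⁻ y, h (a x) (a y) ∂ν ∂ν := by
  rw [lintegral_congr_ae (g := fun ω => ∑ l, (levelCount w a ω l : ℝ≥0∞) *
      ∑ m, h l.succ m.succ * ((levelCount w a ω - Pi.single l 1 : Fin J → ℕ) m : ℕ)),
    hw.lintegral_sum_levelCount_mul ha hfin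
      (fun l k => ∑ m, h l.succ m.succ * ((k m : ℕ) : ℝ≥0∞)),
    lintegral_comp_level ha (fun l => ∫⁻ y, h l (a y) ∂ν) (by simp [h0l])]
  · refine Finset.sum_congr rfl fun l _ => ?_
    rw [lintegral_sum_mul_pi_poissonMeasure, lintegral_comp_level ha _ (hl0 _)]
    simp_rw [ENNReal.coe_toNNReal (hfin _)]
  · filter_upwards [hw.ae_encard_eq_levelCount ha hfin] with ω hω
    exact tsum_tsum_ne_eq_sum (fun i => a (w i ω)) _ hω h h0l hl0

theorem IsPoissonPointProcess.lintegral_tsum_iSup_level [IsProbabilityMeasure P]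
    (hw : IsPoissonPointProcess P w ν)
    (ha : Measurable a) (hfin : ∀ l : Fin J, ν (a ⁻¹' {l.succ}) ≠ ∞)
    (g : Fin (J + 1) → Fin (J + 1) → ℝ) (hg_nonneg : ∀ l m, 0 ≤ g l m) (hg_le : ∀ l m, g l m ≤ 1)
    (h0l : ∀ l, g 0 l = 1) (hl0 : ∀ l, g l 0 = 1) :
    ∫⁻ ω, ∑' i, ⨆ N : ℕ, ENNReal.ofReal (1 - ∏ j ∈ Finset.range N,
        (if i ≠ j then g (a (w i ω)) (a (w j ω)) else 1)) ∂P =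
      ∫⁻ x, ENNReal.ofReal (1 - Real.exp (-∫ y, (1 - g (a x) (a y)) ∂ν)) ∂ν := by
  rw [lintegral_congr_ae (g := fun ω => ∑ l, (levelCount w a ω l : ℝ≥0∞) *
      ENNReal.ofReal (1 - ∏ m, g l.succ m.succ ^
        (levelCount w a ω - Pi.single l 1 : Fin J → ℕ) m)),
    hw.lintegral_sum_levelCount_mul ha hfin
      (fun l k => ENNReal.ofReal (1 - ∏ m, g l.succ m.succ ^ k m)),
    lintegral_comp_level ha
      (fun l => ENNReal.ofReal (1 - Real.exp (-∫ y, (1 - g l (a y)) ∂ν))) (by simp [h0l])]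
  · refine Finset.sum_congr rfl fun l _ => ?_
    rw [lintegral_one_sub_prod_pow_pi_poissonMeasure _ _ (fun _ => hg_nonneg _ _)
      fun _ => hg_le _ _, integral_comp_level ha hfin (fun m => 1 - g l.succ m) (by simp [hl0])
      fun _ => sub_nonneg.2 (hg_le _ _)]
  · filter_upwards [hw.ae_encard_eq_levelCount ha hfin] with ω hω
    exact tsum_iSup_one_sub_prod_eq_sum (fun i => a (w i ω)) _ hω g hg_nonneg hg_le h0l hl0

end Level

/-! ### Monotone limits and dyadic rounding -/

open Filter Topology in
theorem tendsto_tsum_of_monotone {ι : Type*} {f : ℕ → ι → ℝ≥0∞} {F : ι → ℝ≥0∞}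
    (hf : ∀ i, Monotone fun N => f N i) (hF : ∀ i, Tendsto (fun N => f N i) atTop (𝓝 (F i))) :
    Tendsto (fun N => ∑' i, f N i) atTop (𝓝 (∑' i, F i)) := by
  let _ : MeasurableSpace ι := ⊤
  have : DiscreteMeasurableSpace ι := ⟨fun _ => trivial⟩
  simp_rw [← lintegral_count]
  exact lintegral_tendsto_of_tendsto_of_monotone (fun _ => Measurable.of_discrete.aemeasurable)
    (.of_forall hf) (.of_forall hF)

open Filter Topology in
theorem tendsto_iSup_of_monotone {ι : Type*} {f : ℕ → ι → ℝ≥0∞} {F : ι → ℝ≥0∞}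
    (hf : ∀ i, Monotone fun N => f N i) (hF : ∀ i, Tendsto (fun N => f N i) atTop (𝓝 (F i))) :
    Tendsto (fun N => ⨆ i, f N i) atTop (𝓝 (⨆ i, F i)) := by
  have h : ⨆ i, F i = ⨆ N, ⨆ i, f N i := by
    rw [iSup_comm]
    exact iSup_congr fun i => (iSup_eq_of_tendsto (hf i) (hF i)).symm
  rw [h]
  exact tendsto_atTop_iSup fun N N' hN => iSup_mono fun i => hf i hN

/-- The index of the dyadic interval of length `2⁻ᴺ` that contains `x`. -/
noncomputable def gridLevel (N : ℕ) (x : I) : Fin (2 ^ N + 1) :=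
  ⟨⌊(2 : ℝ) ^ N * x⌋₊, Nat.lt_succ_of_le <| Nat.floor_le_of_le <| by
    push_cast
    exact mul_le_of_le_one_right (by positivity) x.2.2⟩

/-- The left end point of a dyadic interval of length `2⁻ᴺ`. -/
noncomputable def gridPoint (N : ℕ) (l : Fin (2 ^ N + 1)) : I :=
  ⟨(l : ℝ) / 2 ^ N, by positivity, div_le_one_of_le₀
    (by exact_mod_cast Nat.le_of_lt_succ l.2) (by positivity)⟩

@[simp]
theorem gridPoint_zero (N : ℕ) : gridPoint N 0 = 0 := by
  ext; simp [gridPoint]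

theorem coe_gridPoint_gridLevel (N : ℕ) (x : I) :
    (gridPoint N (gridLevel N x) : ℝ) = ⌊(2 : ℝ) ^ N * x⌋₊ / 2 ^ N := rfl

theorem measurable_gridLevel (N : ℕ) : Measurable (gridLevel N) := by
  have h : Measurable fun x : I => ⌊(2 : ℝ) ^ N * x⌋₊ :=
    Nat.measurable_floor.comp (measurable_subtype_coe.const_mul _)
  refine measurable_to_countable' fun l => ?_
  have : gridLevel N ⁻¹' {l} = (fun x : I => ⌊(2 : ℝ) ^ N * x⌋₊) ⁻¹' {(l : ℕ)} := by
    ext x; simp [gridLevel, Fin.ext_iff]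
  rw [this]
  exact h (measurableSet_singleton _)

theorem gridPoint_gridLevel_le (N : ℕ) (x : I) : gridPoint N (gridLevel N x) ≤ x := by
  rw [← Subtype.coe_le_coe, coe_gridPoint_gridLevel, div_le_iff₀ (by positivity), mul_comm (x : ℝ)]
  exact Nat.floor_le (mul_nonneg (by positivity) x.2.1)

theorem monotone_gridPoint_gridLevel (x : I) :
    Monotone fun N => gridPoint N (gridLevel N x) := by
  refine monotone_nat_of_le_succ fun N => ?_
  rw [← Subtype.coe_le_coe, coe_gridPoint_gridLevel, coe_gridPoint_gridLevel,
    div_le_div_iff₀ (by positivity) (by positivity), pow_succ]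
  -- Halving the cells can only move the left end point up, since `2⌊t⌋ ≤ ⌊2t⌋`.
  have h : ⌊(2 : ℝ) ^ N * x⌋₊ * 2 ≤ ⌊(2 : ℝ) ^ N * 2 * x⌋₊ := by
    refine Nat.le_floor ?_
    have := Nat.floor_le (mul_nonneg (by positivity) x.2.1 : (0 : ℝ) ≤ 2 ^ N * x)
    push_cast
    nlinarith
  have h' : (⌊(2 : ℝ) ^ N * x⌋₊ : ℝ) * 2 ≤ ⌊(2 : ℝ) ^ N * 2 * x⌋₊ := by exact_mod_cast h
  calc _ = (⌊(2 : ℝ) ^ N * x⌋₊ : ℝ) * 2 * 2 ^ N := by ring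
    _ ≤ _ := mul_le_mul_of_nonneg_right h' (by positivity)

open Filter Topology in
theorem tendsto_gridPoint_gridLevel (x : I) :
    Tendsto (fun N => gridPoint N (gridLevel N x)) atTop (𝓝 x) := by
  rw [tendsto_subtype_rng]
  simp_rw [coe_gridPoint_gridLevel, mul_comm _ (x : ℝ)]
  exact (tendsto_nat_floor_mul_div_atTop x.2.1).comp
    (tendsto_pow_atTop_atTop_of_one_lt one_lt_two)

/-- A nonzero level lies in `{x ≥ 2⁻ᴺ}`, which has finite measure by Markov's inequality. Any
infinite mass is thus confined to level `0`. -/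
theorem measure_gridLevel_succ_ne_top {ν : Measure I}
    (hν : Integrable (fun w : I => (w : ℝ)) ν) (N : ℕ) (l : Fin (2 ^ N)) :
    ν (gridLevel N ⁻¹' {l.succ}) ≠ ∞ := by
  have hlt := hν.measure_norm_ge_lt_top (ε := (1 / 2 ^ N : ℝ)) (by positivity)
  refine ((measure_mono fun x hx => ?_).trans_lt hlt).ne
  have hx' : ⌊(2 : ℝ) ^ N * x⌋₊ = (l : ℕ) + 1 := by
    simpa [gridLevel, Fin.ext_iff] using hx
  have h1 : ((1 : ℕ) : ℝ) ≤ 2 ^ N * x :=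
    (Nat.le_floor_iff' one_ne_zero).1 (by omega)
  simp only [Set.mem_ofPred_eq, Real.norm_of_nonneg x.2.1]
  rw [div_le_iff₀ (by positivity), mul_comm]
  exact_mod_cast h1

/-! ### The two instances of the Mecke formula -/

section Mecke

open Filter Topology

variable {Ω : Type*} [MeasurableSpace Ω] {P : Measure Ω} [IsProbabilityMeasure P]
  {ν : Measure I} {w : ℕ → Ω → I}

/-- The second factorial moment measure of a Poisson point process is `ν ⊗ ν`. -/
theorem IsPoissonPointProcess.tsum_tsum_lintegral_eq (hw : IsPoissonPointProcess P w ν)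
    [SFinite ν] (hν : Integrable (fun w : I => (w : ℝ)) ν) {h : I → I → ℝ≥0∞}
    (hcont : Continuous (Function.uncurry h))
    (hmono : ∀ ⦃x x' y y'⦄, x ≤ x' → y ≤ y' → h x y ≤ h x' y')
    (h0l : ∀ y, h 0 y = 0) (hl0 : ∀ x, h x 0 = 0) :
    ∑' i, ∑' j, ∫⁻ ω, (if i ≠ j then h (w i ω) (w j ω) else 0) ∂P =
      ∫⁻ x, ∫⁻ y, h x y ∂ν ∂ν := by
  have hm (i j : ℕ) : Measurable fun ω => if i ≠ j then h (w i ω) (w j ω) else 0 := by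
    split_ifs
    · exact hcont.measurable.comp ((hw.measurable i).prodMk (hw.measurable j))
    · exact measurable_const
  have hgm (N : ℕ) : Measurable fun x => gridPoint N (gridLevel N x) :=
    Measurable.of_discrete (f := gridPoint N) |>.comp (measurable_gridLevel N)
  have hmN (N i j : ℕ) : Measurable fun ω =>
      if i ≠ j then h (gridPoint N (gridLevel N (w i ω))) (gridPoint N (gridLevel N (w j ω)))
      else 0 := by
    split_ifs
    · exact hcont.measurable.comp
        (((hgm N).comp (hw.measurable i)).prodMk ((hgm N).comp (hw.measurable j)))
    · exact measurable_const
  have hmonoN (x y : I) : Monotone fun N =>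
      h (gridPoint N (gridLevel N x)) (gridPoint N (gridLevel N y)) := fun N N' hN =>
    hmono (monotone_gridPoint_gridLevel x hN) (monotone_gridPoint_gridLevel y hN)
  have htendN (x y : I) : Tendsto (fun N =>
      h (gridPoint N (gridLevel N x)) (gridPoint N (gridLevel N y))) atTop (𝓝 (h x y)) :=
    (hcont.tendsto (x, y)).comp
      ((tendsto_gridPoint_gridLevel x).prodMk_nhds (tendsto_gridPoint_gridLevel y))
  have hmono_ite (ω : Ω) (i j : ℕ) : Monotone fun N =>
      if i ≠ j then h (gridPoint N (gridLevel N (w i ω))) (gridPoint N (gridLevel N (w j ω)))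
      else 0 := by
    split_ifs
    · exact hmonoN _ _
    · exact monotone_const
  have hleft : Tendsto (fun N => ∫⁻ ω, ∑' i, ∑' j, (if i ≠ j then
      h (gridPoint N (gridLevel N (w i ω))) (gridPoint N (gridLevel N (w j ω))) else 0) ∂P) atTop
      (𝓝 (∫⁻ ω, ∑' i, ∑' j, (if i ≠ j then h (w i ω) (w j ω) else 0) ∂P)) := by
    refine lintegral_tendsto_of_tendsto_of_monotone (fun N => Measurable.aemeasurable <|
      .tsum fun i => .tsum fun j => hmN N i j) (.of_forall fun ω N N' hN => ?_)
      (.of_forall fun ω => ?_)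
    · exact ENNReal.tsum_le_tsum fun i => ENNReal.tsum_le_tsum fun j => hmono_ite ω i j hN
    · refine tendsto_tsum_of_monotone
        (fun i N N' hN => ENNReal.tsum_le_tsum fun j => hmono_ite ω i j hN) fun i => ?_
      refine tendsto_tsum_of_monotone (hmono_ite ω i) fun j => ?_
      split_ifs
      · exact htendN _ _
      · exact tendsto_const_nhds
  have hright : Tendsto (fun N => ∫⁻ x, ∫⁻ y,
      h (gridPoint N (gridLevel N x)) (gridPoint N (gridLevel N y)) ∂ν ∂ν) atTop
      (𝓝 (∫⁻ x, ∫⁻ y, h x y ∂ν ∂ν)) := by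
    refine lintegral_tendsto_of_tendsto_of_monotone (fun N => Measurable.aemeasurable ?_)
      (.of_forall fun x N N' hN => lintegral_mono fun y => hmonoN x y hN) (.of_forall fun x => ?_)
    · exact Measurable.lintegral_prod_right (hcont.measurable.comp
        (((hgm N).comp measurable_fst).prodMk ((hgm N).comp measurable_snd)))
    · refine lintegral_tendsto_of_tendsto_of_monotone (fun N => Measurable.aemeasurable ?_)
        (.of_forall fun y => hmonoN x y) (.of_forall fun y => htendN x y)
      exact hcont.measurable.comp (measurable_const.prodMk (hgm N))
  have heq (N : ℕ) := hw.lintegral_tsum_tsum_level (measurable_gridLevel N)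
    (measure_gridLevel_succ_ne_top hν N) (fun l m => h (gridPoint N l) (gridPoint N m))
    (by simp [h0l]) (by simp [hl0])
  simp_rw [heq] at hleft
  rw [tendsto_nhds_unique hright hleft, lintegral_tsum fun i =>
    (Measurable.tsum fun j => hm i j).aemeasurable]
  exact tsum_congr fun i => (lintegral_tsum fun j => (hm i j).aemeasurable).symm

/-- The Mecke formula for the functional `1 - ∏_{j ≠ i} g (wᵢ, wⱼ)`. -/
theorem IsPoissonPointProcess.tsum_lintegral_iSup_eq (hw : IsPoissonPointProcess P w ν)
    (hν : Integrable (fun w : I => (w : ℝ)) ν) {g : I → I → ℝ}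
    (hcont : Continuous (Function.uncurry g))
    (hanti : ∀ ⦃x x' y y'⦄, x ≤ x' → y ≤ y' → g x' y' ≤ g x y)
    (hg_nonneg : ∀ x y, 0 ≤ g x y) (h0l : ∀ y, g 0 y = 1) (hl0 : ∀ x, g x 0 = 1)
    (hint : ∀ x, Integrable (fun y => 1 - g x y) ν) :
    ∑' i, ∫⁻ ω, ⨆ m : ℕ, ENNReal.ofReal (1 - ∏ j ∈ Finset.range m,
        (if i ≠ j then g (w i ω) (w j ω) else 1)) ∂P =
      ∫⁻ x, ENNReal.ofReal (1 - Real.exp (-∫ y, (1 - g x y) ∂ν)) ∂ν := by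
  have hg_le (x y : I) : g x y ≤ 1 := (hanti x.2.1 le_rfl).trans_eq (h0l y)
  have hgm (N : ℕ) : Measurable fun x => gridPoint N (gridLevel N x) :=
    Measurable.of_discrete (f := gridPoint N) |>.comp (measurable_gridLevel N)
  have hm (φ : I → I) (hφ : Measurable φ) (i : ℕ) : Measurable fun ω => ⨆ m : ℕ,
      ENNReal.ofReal (1 - ∏ j ∈ Finset.range m,
        (if i ≠ j then g (φ (w i ω)) (φ (w j ω)) else 1)) := by
    refine .iSup fun m => (measurable_const.sub
      (Finset.measurable_prod _ fun j _ => ?_)).ennreal_ofReal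
    split_ifs
    · exact hcont.measurable.comp
        ((hφ.comp (hw.measurable i)).prodMk (hφ.comp (hw.measurable j)))
    · exact measurable_const
  have hantiN (x y : I) : Antitone fun N =>
      g (gridPoint N (gridLevel N x)) (gridPoint N (gridLevel N y)) := fun N N' hN =>
    hanti (monotone_gridPoint_gridLevel x hN) (monotone_gridPoint_gridLevel y hN)
  have htendN (x y : I) : Tendsto (fun N =>
      g (gridPoint N (gridLevel N x)) (gridPoint N (gridLevel N y))) atTop (𝓝 (g x y)) :=
    (hcont.tendsto (x, y)).comp
      ((tendsto_gridPoint_gridLevel x).prodMk_nhds (tendsto_gridPoint_gridLevel y))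
  have hterm_mono (ω : Ω) (i m : ℕ) : Monotone fun N => ENNReal.ofReal
      (1 - ∏ j ∈ Finset.range m, (if i ≠ j then
        g (gridPoint N (gridLevel N (w i ω))) (gridPoint N (gridLevel N (w j ω))) else 1)) := by
    refine fun N N' hN => ENNReal.ofReal_le_ofReal <| sub_le_sub_left
      (Finset.prod_le_prod (fun j _ => ?_) fun j _ => ?_) _
    · split_ifs
      · exact hg_nonneg _ _
      · exact zero_le_one
    · split_ifs
      · exact hantiN _ _ hN
      · exact le_rfl
  have hterm_tend (ω : Ω) (i m : ℕ) : Tendsto (fun N => ENNReal.ofReal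
      (1 - ∏ j ∈ Finset.range m, (if i ≠ j then
        g (gridPoint N (gridLevel N (w i ω))) (gridPoint N (gridLevel N (w j ω))) else 1))) atTop
      (𝓝 (ENNReal.ofReal (1 - ∏ j ∈ Finset.range m,
        (if i ≠ j then g (w i ω) (w j ω) else 1)))) := by
    refine ENNReal.tendsto_ofReal (tendsto_const_nhds.sub (tendsto_finsetProd _ fun j _ => ?_))
    split_ifs
    · exact htendN _ _
    · exact tendsto_const_nhds
  have hsup_mono (ω : Ω) (i : ℕ) : Monotone fun N => ⨆ m : ℕ, ENNReal.ofReal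
      (1 - ∏ j ∈ Finset.range m, (if i ≠ j then
        g (gridPoint N (gridLevel N (w i ω))) (gridPoint N (gridLevel N (w j ω))) else 1)) :=
    fun N N' hN => iSup_mono fun m => hterm_mono ω i m hN
  have hleft : Tendsto (fun N => ∫⁻ ω, ∑' i, ⨆ m : ℕ, ENNReal.ofReal
      (1 - ∏ j ∈ Finset.range m, (if i ≠ j then
        g (gridPoint N (gridLevel N (w i ω))) (gridPoint N (gridLevel N (w j ω))) else 1)) ∂P)
      atTop (𝓝 (∫⁻ ω, ∑' i, ⨆ m : ℕ, ENNReal.ofReal (1 - ∏ j ∈ Finset.range m,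
        (if i ≠ j then g (w i ω) (w j ω) else 1)) ∂P)) := by
    refine lintegral_tendsto_of_tendsto_of_monotone (fun N => Measurable.aemeasurable <|
      .tsum fun i => hm _ (hgm N) i) (.of_forall fun ω N N' hN =>
        ENNReal.tsum_le_tsum fun i => hsup_mono ω i hN) (.of_forall fun ω => ?_)
    exact tendsto_tsum_of_monotone (hsup_mono ω) fun i =>
      tendsto_iSup_of_monotone (hterm_mono ω i) (hterm_tend ω i)
  have hgrid_meas (N : ℕ) (x : I) : AEStronglyMeasurable (fun y =>
      1 - g (gridPoint N (gridLevel N x)) (gridPoint N (gridLevel N y))) ν :=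
    (measurable_const.sub (hcont.measurable.comp
      (measurable_const.prodMk (hgm N)))).aestronglyMeasurable
  -- Rounding down only decreases `1 - g`, so the unrounded function dominates for all `N`.
  have hgrid_norm (N : ℕ) (x y : I) :
      ‖1 - g (gridPoint N (gridLevel N x)) (gridPoint N (gridLevel N y))‖ ≤ 1 - g x y := by
    rw [Real.norm_of_nonneg (sub_nonneg.2 (hg_le _ _))]
    exact sub_le_sub_left (hanti (gridPoint_gridLevel_le N x) (gridPoint_gridLevel_le N y)) _
  have hgrid_int (N : ℕ) (x : I) : Integrable (fun y =>
      1 - g (gridPoint N (gridLevel N x)) (gridPoint N (gridLevel N y))) ν :=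
    (hint x).mono' (hgrid_meas N x) (.of_forall (hgrid_norm N x))
  have hright : Tendsto (fun N => ∫⁻ x, ENNReal.ofReal (1 - Real.exp (-∫ y,
      (1 - g (gridPoint N (gridLevel N x)) (gridPoint N (gridLevel N y))) ∂ν)) ∂ν) atTop
      (𝓝 (∫⁻ x, ENNReal.ofReal (1 - Real.exp (-∫ y, (1 - g x y) ∂ν)) ∂ν)) := by
    refine lintegral_tendsto_of_tendsto_of_monotone (fun N => Measurable.aemeasurable ?_)
      (.of_forall fun x N N' hN => ?_) (.of_forall fun x => ?_)
    -- The dependence on `x` factors through its level, a discrete variable.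
    · exact (Measurable.of_discrete (f := fun l => ENNReal.ofReal (1 - Real.exp (-∫ y,
        (1 - g (gridPoint N l) (gridPoint N (gridLevel N y))) ∂ν)))).comp (measurable_gridLevel N)
    · refine ENNReal.ofReal_le_ofReal (sub_le_sub_left (Real.exp_le_exp.2 (neg_le_neg ?_)) _)
      exact integral_mono (hgrid_int N x) (hgrid_int N' x) fun y =>
        sub_le_sub_left (hantiN x y hN) _
    · refine ENNReal.tendsto_ofReal (tendsto_const_nhds.sub
        ((Real.continuous_exp.tendsto _).comp (Tendsto.neg ?_)))
      exact tendsto_integral_of_dominated_convergence _ (fun N => hgrid_meas N x) (hint x)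
        (fun N => .of_forall (hgrid_norm N x))
        (.of_forall fun y => tendsto_const_nhds.sub (htendN x y))
  have heq (N : ℕ) := hw.lintegral_tsum_iSup_level (measurable_gridLevel N)
    (measure_gridLevel_succ_ne_top hν N) (fun l m => g (gridPoint N l) (gridPoint N m))
    (fun _ _ => hg_nonneg _ _) (fun _ _ => hg_le _ _) (by simp [h0l]) (by simp [hl0])
  simp_rw [heq] at hleft
  rw [tendsto_nhds_unique hright hleft]
  exact (lintegral_tsum fun i => (hm id measurable_id i).aemeasurable).symm

end Mecke

/-! ### Vertex and edge counts, binomial means -/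

theorem two_mul_tsum_sym2 {α : Type*} [DecidableEq α] (f : Sym2 α → ℝ≥0∞)
    (hf : ∀ i, f s(i, i) = 0) :
    2 * ∑' e, f e = ∑' i, ∑' j, (if i ≠ j then f s(i, j) else 0) := by
  have h (i j : α) : (if i ≠ j then f s(i, j) else 0) = f s(i, j) := by
    split_ifs with hij
    · rfl
    · rw [not_not.1 hij, hf]
  simp_rw [h]
  rw [← ENNReal.tsum_prod (f := fun i j => f s(i, j)),
    ← ENNReal.tsum_fiberwise (fun p : α × α => f s(p.1, p.2)) fun p => s(p.1, p.2),
    ← ENNReal.tsum_mul_left]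
  refine tsum_congr fun e => ?_
  have hfib (p : (fun p : α × α => s(p.1, p.2)) ⁻¹' {e}) :
      f s((p : α × α).1, (p : α × α).2) = f e := congrArg f p.2
  simp_rw [hfib]
  rw [ENNReal.tsum_set_const]
  induction e with | _ i j
  -- A loop has a single preimage, but `f` vanishes there; any other edge has exactly two.
  rcases eq_or_ne i j with rfl | hij
  · simp [hf]
  · have hset : (fun p : α × α => s(p.1, p.2)) ⁻¹' {s(i, j)} = {(i, j), (j, i)} := by
      ext ⟨a, b⟩
      simp
    rw [hset, Set.encard_pair (by simp [hij])]
    rfl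

theorem vertexCount_eq_tsum (G : Sym2 ℕ → ℕ) :
    vertexCount G = ∑' i, (activeVertices G).indicator (fun _ => 1) i := by
  rw [← tsum_subtype, ENNReal.tsum_set_one]
  rfl

theorem activeVertices_binaryGraph (G : Sym2 ℕ → ℕ) :
    activeVertices (binaryGraph G) = activeVertices G := by
  ext i
  simp only [activeVertices, binaryGraph, Set.mem_ofPred_eq]
  refine exists_congr fun j => ?_
  split_ifs with h <;> simp [h]

theorem edgeRate_mk (w : ℕ → I) (i j : ℕ) :
    edgeRate w s(i, j) = if i = j then 0 else w i * w j := rfl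

theorem lintegral_natCast_binomial (n : ℕ) (p : I) :
    ∫⁻ k : ℕ, (k : ℝ≥0∞) ∂(binomial n p) = ENNReal.ofReal (n * p) := by
  have h : ∫ k : ℕ, (k : ℝ) ∂(binomial n p) = n * p := by
    -- The binomial weights are the Bernstein polynomials evaluated at `p`, whose first moment
    -- identity is the mean.
    have hb := congrArg (Polynomial.eval (p : ℝ)) (bernsteinPolynomial.sum_smul ℝ n)
    simp only [Polynomial.eval_finsetSum, bernsteinPolynomial, nsmul_eq_mul, Polynomial.eval_mul,
      Polynomial.eval_natCast, Polynomial.eval_pow, Polynomial.eval_X, Polynomial.eval_sub,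
      Polynomial.eval_one] at hb
    rw [integral_binomial, ← hb, Nat.range_succ_eq_Iic]
    refine Finset.sum_congr rfl fun k _ => ?_
    rw [smul_eq_mul, mul_comm]
  rw [← h, ofReal_integral_eq_lintegral_ofReal (integrable_binomial _)
    (.of_forall fun k => Nat.cast_nonneg k)]
  simp

theorem one_sub_one_sub_pow_le (n : ℕ) {x : ℝ} (hx : x ≤ 1) : 1 - (1 - x) ^ n ≤ n * x := by
  have := one_add_mul_le_pow (a := -x) (by linarith) n
  rw [← sub_eq_add_neg] at this
  linarith

/-! ### Averaging the conditional law of the multiplicities -/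

section EdgeMultiplicity

variable {Ω : Type*} [MeasurableSpace Ω] {P : Measure Ω}
  {w : ℕ → Ω → I} {n : ℕ} {M : Sym2 ℕ → Ω → ℕ}

theorem measurable_edgeRate (hw : ∀ i, Measurable (w i)) (e : Sym2 ℕ) :
    Measurable fun ω => edgeRate (fun i => w i ω) e := by
  induction e with | _ i j
  simp_rw [edgeRate_mk]
  split_ifs
  · exact measurable_const
  · exact (continuous_mul.measurable (α := I × I)).comp ((hw i).prodMk (hw j))

theorem IsEdgeMultiplicity.measurableSet_forall_eq (hM : IsEdgeMultiplicity P w n M)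
    (S : Finset (Sym2 ℕ)) (k : Sym2 ℕ → ℕ) : MeasurableSet {ω | ∀ e ∈ S, M e ω = k e} := by
  have h : {ω | ∀ e ∈ S, M e ω = k e} = ⋂ e ∈ S, M e ⁻¹' {k e} := by ext; simp
  rw [h]
  exact Finset.measurableSet_biInter _ fun e _ => hM.measurable e (measurableSet_singleton _)

theorem measurable_prod_binomial (hw : ∀ i, Measurable (w i)) (n : ℕ) (S : Finset (Sym2 ℕ))
    (k : Sym2 ℕ → ℕ) : Measurable fun ω =>
      ∏ e ∈ S, (binomial n (edgeRate (fun i => w i ω) e)).real {k e} := by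
  refine Finset.measurable_prod _ fun e _ => ?_
  simp_rw [binomial_real_singleton]
  have := measurable_subtype_coe.comp (measurable_edgeRate hw e)
  exact ((this.pow_const _).const_mul _).mul ((measurable_const.sub this).pow_const _)

theorem prod_binomial_le_one (w : ℕ → I) (n : ℕ) (S : Finset (Sym2 ℕ)) (k : Sym2 ℕ → ℕ) :
    ∏ e ∈ S, (binomial n (edgeRate w e)).real {k e} ≤ 1 :=
  Finset.prod_le_one (fun _ _ => measureReal_nonneg) fun _ _ => measureReal_le_one

theorem IsEdgeMultiplicity.integral_prod_binomial [IsProbabilityMeasure P]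
    (hM : IsEdgeMultiplicity P w n M)
    (hw : ∀ i, Measurable (w i)) (S : Finset (Sym2 ℕ)) (k : Sym2 ℕ → ℕ) :
    P.real {ω | ∀ e ∈ S, M e ω = k e} =
      ∫ ω, ∏ e ∈ S, (binomial n (edgeRate (fun i => w i ω) e)).real {k e} ∂P := by
  rw [← integral_congr_ae (hM.condLaw S k), integral_condExp (measurable_pi_lambda _ hw).comap_le]
  exact (integral_indicator_one (hM.measurableSet_forall_eq S k)).symm

theorem integrable_prod_binomial [IsFiniteMeasure P] (hw : ∀ i, Measurable (w i)) (n : ℕ)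
    (S : Finset (Sym2 ℕ)) (k : Sym2 ℕ → ℕ) : Integrable (fun ω =>
      ∏ e ∈ S, (binomial n (edgeRate (fun i => w i ω) e)).real {k e}) P :=
  .of_bound (measurable_prod_binomial hw n S k).aestronglyMeasurable 1 <| .of_forall fun ω => by
    rw [Real.norm_of_nonneg (Finset.prod_nonneg fun _ _ => measureReal_nonneg)]
    exact prod_binomial_le_one _ n S k

/-- The complement is the event that all multiplicities in `S` are zero, whose conditional
probability is the product of the binomial weights at `0`. -/
theorem IsEdgeMultiplicity.measure_exists_pos [IsProbabilityMeasure P]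
    (hM : IsEdgeMultiplicity P w n M)
    (hw : ∀ i, Measurable (w i)) (S : Finset (Sym2 ℕ)) :
    P {ω | ∃ e ∈ S, 0 < M e ω} = ∫⁻ ω, ENNReal.ofReal
      (1 - ∏ e ∈ S, (1 - (edgeRate (fun i => w i ω) e : ℝ)) ^ n) ∂P := by
  have hcompl : {ω | ∃ e ∈ S, 0 < M e ω} = {ω | ∀ e ∈ S, M e ω = (0 : Sym2 ℕ → ℕ) e}ᶜ := by
    ext ω
    simp [Nat.pos_iff_ne_zero]
  have hint := integrable_prod_binomial (P := P) hw n S 0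
  have hint' : Integrable (fun ω => 1 -
      ∏ e ∈ S, (binomial n (edgeRate (fun i => w i ω) e)).real {(0 : Sym2 ℕ → ℕ) e}) P :=
    (integrable_const 1).sub hint
  have hreal := probReal_compl_eq_one_sub (μ := P) (hM.measurableSet_forall_eq S 0)
  rw [hM.integral_prod_binomial hw] at hreal
  rw [hcompl, ← ofReal_measureReal, hreal]
  have h1 : (1 : ℝ) = ∫ _, 1 ∂P := by simp
  nth_rw 1 [h1]
  rw [← integral_sub (integrable_const 1) hint, ofReal_integral_eq_lintegral_ofReal hint'
    (.of_forall fun ω => sub_nonneg.2 (prod_binomial_le_one _ n S 0))]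
  simp [binomial_real_zero]

theorem IsEdgeMultiplicity.lintegral_eq [IsProbabilityMeasure P]
    (hM : IsEdgeMultiplicity P w n M)
    (hw : ∀ i, Measurable (w i)) (e : Sym2 ℕ) :
    ∫⁻ ω, (M e ω : ℝ≥0∞) ∂P =
      ∫⁻ ω, ENNReal.ofReal (n * (edgeRate (fun i => w i ω) e : ℝ)) ∂P := by
  have hk (k : ℕ) : P (M e ⁻¹' {k}) =
      ∫⁻ ω, binomial n (edgeRate (fun i => w i ω) e) {k} ∂P := by
    have hset : M e ⁻¹' {k} = {ω | ∀ e' ∈ ({e} : Finset (Sym2 ℕ)), M e' ω = (fun _ => k) e'} := by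
      ext; simp
    rw [hset, ← ofReal_measureReal, hM.integral_prod_binomial hw,
      ofReal_integral_eq_lintegral_ofReal (integrable_prod_binomial hw n _ _)
      (.of_forall fun ω => Finset.prod_nonneg fun _ _ => measureReal_nonneg)]
    simp
  have hmeas (k : ℕ) : Measurable fun ω => binomial n (edgeRate (fun i => w i ω) e) {k} := by
    have := (measurable_prod_binomial hw n {e} fun _ => k).ennreal_ofReal
    simpa using this
  rw [← lintegral_map (f := fun k : ℕ => (k : ℝ≥0∞)) .of_discrete (hM.measurable e),
    lintegral_countable']
  simp_rw [Measure.map_apply (hM.measurable e) (measurableSet_singleton _), hk]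
  simp_rw [← lintegral_const_mul _ (hmeas _)]
  rw [← lintegral_tsum fun k => ((hmeas k).const_mul _).aemeasurable]
  refine lintegral_congr fun ω => ?_
  rw [← lintegral_natCast_binomial, lintegral_countable']

theorem IsEdgeMultiplicity.lintegral_binaryGraph_eq [IsProbabilityMeasure P]
    (hM : IsEdgeMultiplicity P w n M)
    (hw : ∀ i, Measurable (w i)) (e : Sym2 ℕ) :
    ∫⁻ ω, (binaryGraph (fun e => M e ω) e : ℝ≥0∞) ∂P =
      ∫⁻ ω, ENNReal.ofReal (1 - (1 - (edgeRate (fun i => w i ω) e : ℝ)) ^ n) ∂P := by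
  have h := hM.measure_exists_pos hw {e}
  simp only [Finset.mem_singleton, exists_eq_left, Finset.prod_singleton] at h
  rw [← h, ← lintegral_indicator_one (measurableSet_lt measurable_const (hM.measurable e))]
  refine lintegral_congr fun ω => ?_
  by_cases hω : 0 < M e ω <;> simp [binaryGraph, hω]

theorem IsEdgeMultiplicity.measurableSet_mem_activeVertices (hM : IsEdgeMultiplicity P w n M)
    (i : ℕ) : MeasurableSet {ω | i ∈ activeVertices fun e => M e ω} := by
  have h : {ω | i ∈ activeVertices fun e => M e ω} = ⋃ j, {ω | 0 < M s(i, j) ω} := by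
    ext; simp [activeVertices]
  rw [h]
  exact .iUnion fun j => measurableSet_lt measurable_const (hM.measurable _)

theorem IsEdgeMultiplicity.measure_mem_activeVertices [IsProbabilityMeasure P]
    (hM : IsEdgeMultiplicity P w n M)
    (hw : ∀ i, Measurable (w i)) (i : ℕ) :
    P {ω | i ∈ activeVertices fun e => M e ω} =
      ∫⁻ ω, ⨆ m : ℕ, ENNReal.ofReal (1 - ∏ j ∈ Finset.range m,
        (if i ≠ j then (1 - (w i ω : ℝ) * w j ω) ^ n else 1)) ∂P := by
  classical
  -- Finite sets of edges exhausting the star of `i`. The loop `s(i, i)` may belong to `S m`, but it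
  -- has rate `0` and contributes the factor `1`.
  let S (m : ℕ) : Finset (Sym2 ℕ) := (Finset.range m).image fun j => s(i, j)
  have hS : Monotone S := fun m m' h =>
    Finset.image_subset_image (Finset.range_subset_range.2 h)
  have hset : {ω | i ∈ activeVertices fun e => M e ω} = ⋃ m, {ω | ∃ e ∈ S m, 0 < M e ω} := by
    ext ω
    simp only [activeVertices, Set.mem_ofPred_eq, Set.mem_iUnion, S, Finset.mem_image,
      Finset.mem_range]
    constructor
    · rintro ⟨j, hj⟩
      exact ⟨j + 1, s(i, j), ⟨j, j.lt_succ_self, rfl⟩, hj⟩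
    · rintro ⟨m, _, ⟨j, _, rfl⟩, hj⟩
      exact ⟨j, hj⟩
  have hprod (m : ℕ) (ω : Ω) : ∏ e ∈ S m, (1 - (edgeRate (fun i => w i ω) e : ℝ)) ^ n =
      ∏ j ∈ Finset.range m, (if i ≠ j then (1 - (w i ω : ℝ) * w j ω) ^ n else 1) := by
    rw [Finset.prod_image fun j _ j' _ h => Sym2.congr_right.1 h]
    refine Finset.prod_congr rfl fun j _ => ?_
    rw [edgeRate_mk]
    by_cases hij : i = j <;> simp [hij]
  have hset_mono : Monotone fun m => {ω | ∃ e ∈ S m, 0 < M e ω} :=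
    fun m m' h ω ⟨e, he, hpos⟩ => ⟨e, hS h he, hpos⟩
  rw [hset, hset_mono.measure_iUnion]
  simp_rw [hM.measure_exists_pos hw, hprod]
  refine (lintegral_iSup (fun m => ?_) fun m m' h ω => ?_).symm
  · refine (measurable_const.sub (Finset.measurable_prod _ fun j _ => ?_)).ennreal_ofReal
    split_ifs
    · exact (measurable_const.sub ((measurable_subtype_coe.comp (hw i)).mul
        (measurable_subtype_coe.comp (hw j)))).pow_const _
    · exact measurable_const
  · have h01 (j : ℕ) : 0 ≤ (1 - (w i ω : ℝ) * w j ω) ∧ (1 - (w i ω : ℝ) * w j ω) ≤ 1 :=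
      ⟨sub_nonneg.2 (mul_le_one₀ (w i ω).2.2 (w j ω).2.1 (w j ω).2.2),
        sub_le_self _ (mul_nonneg (w i ω).2.1 (w j ω).2.1)⟩
    refine ENNReal.ofReal_le_ofReal (sub_le_sub_left ?_ _)
    refine Finset.prod_le_prod_of_subset_of_le_one (Finset.range_subset_range.2 h)
      (fun j _ => ?_) fun j _ _ => ?_ <;> split_ifs
    · exact pow_nonneg (h01 j).1 _
    · exact zero_le_one
    · exact pow_le_one₀ (h01 j).1 (h01 j).2
    · exact le_rfl

end EdgeMultiplicity

/-! ### The expectations -/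

theorem hasExpectation_vertexCount {Ω : Type*} [MeasurableSpace Ω] {P : Measure Ω}
    [IsProbabilityMeasure P] {ν : Measure I} (hν : Integrable (fun w : I => (w : ℝ)) ν)
    {w : ℕ → Ω → I} (hw : IsPoissonPointProcess P w ν)
    {n : ℕ} {M : Sym2 ℕ → Ω → ℕ} (hM : IsEdgeMultiplicity P w n M)
    (hint : ∀ w : I, Integrable (fun v : I => 1 - (1 - (w : ℝ) * v) ^ n) ν)
    (hint' : Integrable
      (fun w : I => 1 - Real.exp (-∫ v : I, (1 - (1 - (w : ℝ) * v) ^ n) ∂ν)) ν) :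
    HasExpectation P (fun ω => vertexCount fun e => M e ω)
      (∫ w : I, (1 - Real.exp (-∫ v : I, (1 - (1 - (w : ℝ) * v) ^ n) ∂ν)) ∂ν) := by
  have h01 (x y : I) : 0 ≤ 1 - (x : ℝ) * y ∧ 1 - (x : ℝ) * y ≤ 1 :=
    ⟨sub_nonneg.2 (mul_le_one₀ x.2.2 y.2.1 y.2.2), sub_le_self _ (mul_nonneg x.2.1 y.2.1)⟩
  have hnn (x : I) : 0 ≤ 1 - Real.exp (-∫ v : I, (1 - (1 - (x : ℝ) * v) ^ n) ∂ν) := by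
    rw [sub_nonneg, Real.exp_le_one_iff, neg_nonpos]
    exact integral_nonneg fun y => sub_nonneg.2 (pow_le_one₀ (h01 x y).1 (h01 x y).2)
  have hm (i : ℕ) : Measurable fun ω =>
      (activeVertices fun e => M e ω).indicator (fun _ => (1 : ℝ≥0∞)) i :=
    measurable_const.indicator (hM.measurableSet_mem_activeVertices i)
  simp_rw [HasExpectation, vertexCount_eq_tsum]
  refine ⟨(Measurable.tsum hm).aemeasurable, integral_nonneg hnn, ?_⟩
  rw [lintegral_tsum fun i => (hm i).aemeasurable,
    ofReal_integral_eq_lintegral_ofReal hint' (.of_forall hnn),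
    ← hw.tsum_lintegral_iSup_eq hν (g := fun x y => (1 - (x : ℝ) * y) ^ n)
      (by fun_prop) (fun x x' y y' hx hy => pow_le_pow_left₀ (h01 x' y').1
        (sub_le_sub_left (mul_le_mul (Subtype.coe_le_coe.2 hx) (Subtype.coe_le_coe.2 hy)
          y.2.1 x'.2.1) _) _)
      (fun x y => pow_nonneg (h01 x y).1 _) (by simp) (by simp) hint]
  refine tsum_congr fun i => ?_
  rw [← hM.measure_mem_activeVertices hw.measurable,
    ← lintegral_indicator_one (hM.measurableSet_mem_activeVertices i)]
  rfl

/-- Only the mean of each edge variable matters, by linearity; the general `φ` serves the multigraph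
and the binary graph at once. Monotonicity of `φ` is what the dyadic approximation needs. -/
theorem hasExpectation_edgeCount {Ω : Type*} [MeasurableSpace Ω] {P : Measure Ω}
    [IsProbabilityMeasure P] {ν : Measure I} [SFinite ν]
    (hν : Integrable (fun w : I => (w : ℝ)) ν) {w : ℕ → Ω → I} (hw : IsPoissonPointProcess P w ν)
    {X : Sym2 ℕ → Ω → ℕ} (hX : ∀ e, Measurable (X e)) {φ : ℝ → ℝ} (hφ : Continuous φ)
    (hφ_mono : MonotoneOn φ (Set.Icc 0 1)) (hφ_zero : φ 0 = 0)
    (hφ_int : Integrable (fun p : I × I => φ (p.1 * p.2)) (ν.prod ν))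
    (hlaw : ∀ e, ∫⁻ ω, (X e ω : ℝ≥0∞) ∂P =
      ∫⁻ ω, ENNReal.ofReal (φ (edgeRate (fun i => w i ω) e)) ∂P) :
    HasExpectation P (fun ω => edgeCount fun e => X e ω)
      ((1 : ℝ) / 2 * ∫ v : I, ∫ w : I, φ (w * v) ∂ν ∂ν) := by
  have hmul (x y : I) : (x * y : ℝ) ∈ Set.Icc (0 : ℝ) 1 := (x * y).2
  have hnn (x y : I) : 0 ≤ φ (x * y) :=
    hφ_zero ▸ hφ_mono (by simp) (hmul x y) (hmul x y).1
  have hprod : ENNReal.ofReal (∫ v : I, ∫ w : I, φ (w * v) ∂ν ∂ν) =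
      ∫⁻ x : I, ∫⁻ y : I, ENNReal.ofReal (φ (x * y)) ∂ν ∂ν := by
    simp_rw [mul_comm (_ : ℝ) _]
    have hc : Continuous fun p : I × I => ENNReal.ofReal (φ (p.1 * p.2)) :=
      ENNReal.continuous_ofReal.comp (by fun_prop)
    rw [← integral_prod _ hφ_int, ofReal_integral_eq_lintegral_ofReal hφ_int
      (.of_forall fun p => hnn _ _), lintegral_prod _ hc.measurable.aemeasurable]
  have htwo : 2 * ∑' e, ∫⁻ ω, (X e ω : ℝ≥0∞) ∂P =
      ENNReal.ofReal (∫ v : I, ∫ w : I, φ (w * v) ∂ν ∂ν) := by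
    simp_rw [hlaw]
    rw [hprod, two_mul_tsum_sym2 _ fun i => by simp [edgeRate_mk, hφ_zero],
      ← hw.tsum_tsum_lintegral_eq hν (h := fun x y => ENNReal.ofReal (φ (x * y)))
        (ENNReal.continuous_ofReal.comp (f := fun p : I × I => φ (p.1 * p.2)) (by fun_prop))
        (fun x x' y y' hx hy => ENNReal.ofReal_le_ofReal <| hφ_mono (hmul _ _) (hmul _ _) <|
          mul_le_mul hx hy y.2.1 x'.2.1) (by simp [hφ_zero]) (by simp [hφ_zero])]
    refine tsum_congr fun i => tsum_congr fun j => ?_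
    by_cases hij : i = j <;> simp [edgeRate_mk, hij]
  have hm (e : Sym2 ℕ) : Measurable fun ω => (X e ω : ℝ≥0∞) :=
    (Measurable.of_discrete (f := fun k : ℕ => (k : ℝ≥0∞))).comp (hX e)
  refine ⟨(Measurable.tsum hm).aemeasurable,
    mul_nonneg (by norm_num) (integral_nonneg fun v => integral_nonneg fun w => hnn w v), ?_⟩
  unfold edgeCount
  rw [lintegral_tsum fun e => (hm e).aemeasurable, ENNReal.ofReal_mul (by norm_num), ← htwo,
    ← mul_assoc, one_div, ENNReal.ofReal_inv_of_pos two_pos, ENNReal.ofReal_ofNat,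
    ENNReal.inv_mul_cancel (by simp) (by simp), one_mul]

theorem lemma2 {Ω : Type*} [MeasurableSpace Ω] (P : Measure Ω) [IsProbabilityMeasure P]
    (ν : Measure I) [SigmaFinite ν] [NullSingletonClass ν]
    (hν_inf : ν Set.univ = ∞) (hν_int : Integrable (fun w : I => (w : ℝ)) ν)
    (w : ℕ → Ω → I) (hw : IsPoissonPointProcess P w ν)
    (n : ℕ) (M : Sym2 ℕ → Ω → ℕ) (hM : IsEdgeMultiplicity P w n M) :
    -- the integrals in the formulas converge
    (∀ w : I, Integrable (fun v : I => 1 - (1 - (w : ℝ) * v) ^ n) ν) ∧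
    Integrable (fun w : I => 1 - Real.exp (-∫ v : I, (1 - (1 - (w : ℝ) * v) ^ n) ∂ν)) ν ∧
    Integrable (fun p : I × I => (p.1 : ℝ) * p.2) (ν.prod ν) ∧
    Integrable (fun p : I × I => 1 - (1 - (p.1 : ℝ) * p.2) ^ n) (ν.prod ν) ∧
    -- vertices of the binary graph and of the multigraph
    HasExpectation P (fun ω => vertexCount (binaryGraph fun e => M e ω))
      (∫ w : I, (1 - Real.exp (-∫ v : I, (1 - (1 - (w : ℝ) * v) ^ n) ∂ν)) ∂ν) ∧
    HasExpectation P (fun ω => vertexCount fun e => M e ω)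
      (∫ w : I, (1 - Real.exp (-∫ v : I, (1 - (1 - (w : ℝ) * v) ^ n) ∂ν)) ∂ν) ∧
    -- edges of the multigraph
    HasExpectation P (fun ω => edgeCount fun e => M e ω)
      ((n : ℝ) / 2 * ∫ v : I, ∫ w : I, (w : ℝ) * v ∂ν ∂ν) ∧
    -- edges of the binary graph
    HasExpectation P (fun ω => edgeCount (binaryGraph fun e => M e ω))
      ((1 : ℝ) / 2 * ∫ v : I, ∫ w : I, (1 - (1 - (w : ℝ) * v) ^ n) ∂ν ∂ν) := by

  have h01 (x y : I) : 0 ≤ 1 - (x : ℝ) * y ∧ 1 - (x : ℝ) * y ≤ 1 :=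
    ⟨sub_nonneg.2 (mul_le_one₀ x.2.2 y.2.1 y.2.2), sub_le_self _ (mul_nonneg x.2.1 y.2.1)⟩
  have hnn (x y : I) : 0 ≤ 1 - (1 - (x : ℝ) * y) ^ n :=
    sub_nonneg.2 (pow_le_one₀ (h01 x y).1 (h01 x y).2)
  have hle (x y : I) : 1 - (1 - (x : ℝ) * y) ^ n ≤ n * (x * y) :=
    one_sub_one_sub_pow_le n (x * y).2.2
  have hint1 (x : I) : Integrable (fun v : I => 1 - (1 - (x : ℝ) * v) ^ n) ν := by
    refine ((hν_int.const_mul (x : ℝ)).const_mul (n : ℝ)).mono' (by fun_prop)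
      (.of_forall fun y => ?_)
    rw [Real.norm_of_nonneg (hnn x y)]
    exact hle x y
  have hint3 : Integrable (fun p : I × I => (p.1 : ℝ) * p.2) (ν.prod ν) := hν_int.mul_prod hν_int
  have hint4 : Integrable (fun p : I × I => 1 - (1 - (p.1 : ℝ) * p.2) ^ n) (ν.prod ν) := by
    refine (hint3.const_mul (n : ℝ)).mono' (by fun_prop) (.of_forall fun p => ?_)
    rw [Real.norm_of_nonneg (hnn _ _)]
    exact hle _ _
  have hint2 : Integrable
      (fun w : I => 1 - Real.exp (-∫ v : I, (1 - (1 - (w : ℝ) * v) ^ n) ∂ν)) ν := by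
    -- The bound `1 - exp(-t) ≤ t` dominates the integrand by the inner integral, which is
    -- integrable by Fubini.
    refine hint4.integral_prod_left.mono' ?_ (.of_forall fun x => ?_)
    · exact aestronglyMeasurable_const.sub
        (Real.continuous_exp.comp_aestronglyMeasurable hint4.integral_prod_left.1.neg)
    · have h0 : 0 ≤ ∫ v : I, (1 - (1 - (x : ℝ) * v) ^ n) ∂ν := integral_nonneg (hnn x)
      rw [Real.norm_of_nonneg (sub_nonneg.2 (Real.exp_le_one_iff.2 (neg_nonpos.2 h0)))]
      linarith [Real.add_one_le_exp (-∫ v : I, (1 - (1 - (x : ℝ) * v) ^ n) ∂ν)]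
  have hV := hasExpectation_vertexCount hν_int hw hM hint1 hint2
  refine ⟨hint1, hint2, hint3, hint4, ?_, hV, ?_, ?_⟩
  · simp_rw [vertexCount, activeVertices_binaryGraph]
    exact hV
  · have h := hasExpectation_edgeCount hν_int hw hM.measurable (φ := fun x => n * x)
      (by fun_prop) (fun x _ y _ hxy => mul_le_mul_of_nonneg_left hxy (by positivity)) (by simp)
      (hint3.const_mul _) (hM.lintegral_eq hw.measurable)
    simp_rw [integral_const_mul] at h
    rwa [← mul_assoc, one_div_mul_eq_div] at h
  · refine hasExpectation_edgeCount hν_int hw (X := fun e ω => binaryGraph (fun e => M e ω) e)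
      (fun e => ?_) (φ := fun x => 1 - (1 - x) ^ n) (by fun_prop) (fun x _ y hy hxy => ?_)
      (by simp) hint4 (hM.lintegral_binaryGraph_eq hw.measurable)
    · exact (Measurable.of_discrete (f := fun k : ℕ => if 0 < k then 1 else 0)).comp
        (hM.measurable e)
    · exact sub_le_sub_left (pow_le_pow_left₀ (sub_nonneg.2 hy.2) (sub_le_sub_left hxy _) _) _
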